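/- Let $d \ge 0$ and let $\mathcal P_2(\mathbb R^d)$ be the set of Borel probability measures on $\mathbb R^d$ with finite second moment. For $\mu,\nu \in \mathcal P_2(\mathbb R^d)$ let $\Gamma_{\mu,\nu}$ be the set of couplings of $\mu$ and $\nu$, i.e. of measures on $\mathbb R^d\times\mathbb R^d$ with first marginal $\mu$ and second marginal $\nu$, and let $$W_2(\mu,\nu) = \inf_{\gamma\in\Gamma_{\mu,\nu}} \Bigl(\int \|x-y\|^2\,\gamma(\mathrm dx,\mathrm dy)\Bigr)^{1/2}.$$ A coupling $\bar\gamma\in\Gamma_{\mu,\nu}$ is optimal if $$\int \|x-y\|^2\,\bar\gamma(\mathrm dx,\mathrm dy) = \min_{\gamma\in\Gamma_{\mu,\nu}} \int \|x-y\|^2\,\gamma(\mathrm dx,\mathrm dy) = W_2^2(\mu,\nu).$$ A convex function is a function $\varphi:\mathbb R^d\to\mathbb R\cup\{\infty\}$, not identically $\infty$, with $\varphi((1-t)x+ty)\le(1-t)\varphi(x)+t\varphi(y)$ for all $x,y\in\mathbb R^d$ and $t\in[0,1]$; it is differentiable at $x$ if it is finite near $x$ and differentiable at $x$ there. **Theorem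 (Improved Brenier).** Let $\mu,\nu\in\mathcal P_2(\mathbb R^d)$, suppose that $\mu$ has a density with respect to Lebesgue measure, and let $X\sim\mu$. 1. There is a convex function $\varphi:\mathbb R^d\to\mathbb R\cup\{\infty\}$, differentiable $\mu$-almost everywhere, such that the law $\bar\gamma$ of $(X,\nabla\varphi(X))$ is an optimal coupling of $\mu$ and $\nu$. 2. The gradient $\nabla\varphi$ is unique: if $\psi:\mathbb R^d\to\mathbb R\cup\{\infty\}$ is a convex function that is finite $\mu$-almost everywhere (and hence differentiable $\mu$-almost everywhere) and $\nabla\psi(X)\sim\nu$, then $\nabla\psi(X)=\nabla\varphi(X)$ almost surely. 3. If $\gamma\in\Gamma_{\mu,\nu}$ is the law of $(X,\nabla\psi(X))$ for some convex function $\psi:\mathbb R^d\to\mathbb R\cup\{\infty\}$ that is finite $\mu$-almost everywhere, then $\gamma$ is the unique optimal coupling of $\mu$ and $\nu$. -/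

import Mathlib

open MeasureTheory ProbabilityTheory
open scoped ENNReal

noncomputable section

namespace OT

/-- The Euclidean space `ℝ^d`. -/
abbrev Rd (d : ℕ) : Type := EuclideanSpace ℝ (Fin d)

/-- `𝒫₂(ℝ^d)`: the Borel probability measures on `ℝ^d` with finite second moment. -/
def P2 (d : ℕ) : Set (Measure (Rd d)) :=
  {μ | IsProbabilityMeasure μ ∧ ∫⁻ x, ‖x‖ₑ ^ 2 ∂μ < ∞}

variable {d : ℕ}

/-- The set `Γ_{μ,ν}` of couplings: the measures on `ℝ^d × ℝ^d` with marginals `μ` and `ν`. -/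
def couplings (μ ν : Measure (Rd d)) : Set (Measure (Rd d × Rd d)) :=
  {γ | γ.map Prod.fst = μ ∧ γ.map Prod.snd = ν}

/-- The quadratic transport cost `∫ ‖x - y‖² γ(dx, dy)`, with values in `[0, ∞]`. -/
def cost (γ : Measure (Rd d × Rd d)) : ℝ≥0∞ :=
  ∫⁻ z, ‖z.1 - z.2‖ₑ ^ 2 ∂γ

/-- The 2-Wasserstein distance, with values in `[0, ∞]` (it is finite on `𝒫₂(ℝ^d)`). -/
def W2 (μ ν : Measure (Rd d)) : ℝ≥0∞ :=
  ⨅ γ ∈ couplings μ ν, cost γ ^ (1 / 2 : ℝ)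

/-- `γ` is an optimal coupling of `μ` and `ν`: it is a coupling, its cost is the least cost of
a coupling, and this minimum is `W₂²(μ, ν)`. -/
structure IsOptimalCoupling (μ ν : Measure (Rd d)) (γ : Measure (Rd d × Rd d)) : Prop where
  mem : γ ∈ couplings μ ν
  isLeast : IsLeast (cost '' couplings μ ν) (cost γ)
  cost_eq : cost γ = W2 μ ν ^ 2

/-- `φ : ℝ^d → ℝ ∪ {∞}` is a (proper) convex function. In `EReal` one has `0 * ⊤ = 0`, and the
sum below never has the form `⊤ + ⊥`, because `φ` does not take the value `⊥`. -/
structure IsConvex (φ : Rd d → EReal) : Prop where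
  ne_bot : ∀ x, φ x ≠ ⊥
  exists_ne_top : ∃ x, φ x ≠ ⊤
  le : ∀ x y : Rd d, ∀ t : ℝ, 0 ≤ t → t ≤ 1 →
    φ ((1 - t) • x + t • y) ≤ ((1 - t : ℝ) : EReal) * φ x + (t : EReal) * φ y

/-- `φ : ℝ^d → ℝ ∪ {∞}` is differentiable at `x`: it is finite in a neighbourhood of `x` and, as
a real function there, differentiable at `x`. -/
def IsDiffAt (φ : Rd d → EReal) (x : Rd d) : Prop :=
  (∀ᶠ z in nhds x, φ z ≠ ⊥ ∧ φ z ≠ ⊤) ∧ DifferentiableAt ℝ (fun z => (φ z).toReal) x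

/-- The gradient `∇φ(x)`, meaningful at the points where `φ` is differentiable in the sense of
`IsDiffAt`. -/
def grad (φ : Rd d → EReal) (x : Rd d) : Rd d :=
  gradient (fun z => (φ z).toReal) x

end OT

end

/-! Expanding the square, a coupling is cheap when it makes the integral of `⟪x, y⟫` large. For
convex `ψ` with conjugate `ψ*`, Fenchel–Young gives `⟪x, y⟫ ≤ ψ x + ψ* y`, and where `ψ` is
differentiable equality forces `y = ∇ψ x`. The right side has the same integral under every
coupling. So a coupling carried by the graph of `∇ψ` is optimal, and any coupling of no greater cost
lives on the same graph (`cost_le_of_grad`). This gives both uniqueness statements, since a coupling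
on a graph is determined by its first marginal.

For existence, compactness yields an optimal coupling (`exists_cost_le`). Its support is cyclically
monotone, as otherwise exchanging mass near finitely many points would lower the cost
(`cyclicallyMonotone_support`). Rockafellar's potential then has the pairs of the support as
subgradients. It is finite, hence differentiable, `μ`-almost everywhere because `μ` has a density,
and there the only subgradient is the gradient (`exists_isConvex_grad`). -/

/-! ### Convex functions: almost everywhere differentiability and subgradients -/

namespace OT

open Set Filter Topology

variable {d : ℕ} {φ : Rd d → EReal}

/-- The domain of finiteness of a convex function. -/
def dom (φ : Rd d → EReal) : Set (Rd d) := {x | φ x ≠ ⊤}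

lemma IsConvex.coe_toReal (hφ : IsConvex φ) {x : Rd d} (hx : x ∈ dom φ) :
    ((φ x).toReal : EReal) = φ x :=
  EReal.coe_toReal hx (hφ.ne_bot x)

lemma IsConvex.le_coe (hφ : IsConvex φ) {x y : Rd d} (hx : x ∈ dom φ) (hy : y ∈ dom φ)
    {a b : ℝ} (ha : 0 ≤ a) (hb : 0 ≤ b) (hab : a + b = 1) :
    φ (a • x + b • y) ≤ ((a * (φ x).toReal + b * (φ y).toReal : ℝ) : EReal) := by
  have h := hφ.le x y b hb (by linarith)
  rw [← hφ.coe_toReal hx, ← hφ.coe_toReal hy, show 1 - b = a by linarith] at h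
  exact_mod_cast h

lemma IsConvex.convexOn (hφ : IsConvex φ) :
    ConvexOn ℝ (dom φ) (fun x => (φ x).toReal) := by
  have key : ∀ x ∈ dom φ, ∀ y ∈ dom φ, ∀ a b : ℝ, 0 ≤ a → 0 ≤ b → a + b = 1 →
      a • x + b • y ∈ dom φ := fun x hx y hy a b ha hb hab =>
    ne_top_of_le_ne_top (EReal.coe_ne_top _) (hφ.le_coe hx hy ha hb hab)
  refine ⟨fun x hx y hy a b ha hb hab => key x hx y hy a b ha hb hab, ?_⟩
  intro x hx y hy a b ha hb hab
  have h := hφ.le_coe hx hy ha hb hab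
  rw [← hφ.coe_toReal (key x hx y hy a b ha hb hab)] at h
  exact_mod_cast h

lemma IsConvex.convexOn_interior (hφ : IsConvex φ) :
    ConvexOn ℝ (interior (dom φ)) (fun x => (φ x).toReal) :=
  hφ.convexOn.subset interior_subset hφ.convexOn.1.interior

lemma IsDiffAt.mem_interior_dom {x : Rd d} (h : IsDiffAt φ x) : x ∈ interior (dom φ) :=
  mem_interior_iff_mem_nhds.2 (h.1.mono fun _ hz => hz.2)

/-- A function convex on an open set is differentiable almost everywhere on it. -/
lemma _root_.ConvexOn.ae_differentiableAt {E : Type*} [NormedAddCommGroup E] [NormedSpace ℝ E]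
    [FiniteDimensional ℝ E] [MeasurableSpace E] [BorelSpace E] (μ : Measure E)
    [μ.IsAddHaarMeasure] {U : Set E} {f : E → ℝ} (hf : ConvexOn ℝ U f) (hU : IsOpen U) :
    ∀ᵐ x ∂μ, x ∈ U → DifferentiableAt ℝ f x := by
  have hL := hf.locallyLipschitzOn hU
  -- Rademacher's theorem applies near each point, where `f` is Lipschitz; a locally null set is
  -- null.
  have : ∀ x ∈ U, ∃ t ∈ 𝓝[U] x, μ (t ∩ {x | x ∈ U ∧ ¬ DifferentiableAt ℝ f x}) = 0 := by
    intro x hx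
    obtain ⟨K, t, ht, hK⟩ := hL hx
    rw [hU.nhdsWithin_eq hx] at ht ⊢
    refine ⟨interior t, interior_mem_nhds.2 ht, ?_⟩
    have := (hK.mono interior_subset).ae_differentiableWithinAt_of_mem (μ := μ)
    rw [ae_iff] at this
    refine measure_mono_null ?_ this
    rintro y ⟨hy, -, hd⟩ h
    exact hd ((h hy).differentiableAt (isOpen_interior.mem_nhds hy))
  rw [ae_iff]
  have h0 := measure_null_of_locally_null {x | x ∈ U ∧ ¬ DifferentiableAt ℝ f x} (μ := μ)
    (fun x hx => by
      obtain ⟨t, ht, h⟩ := this x hx.1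
      refine ⟨t ∩ {x | x ∈ U ∧ ¬ DifferentiableAt ℝ f x}, ?_, h⟩
      exact inter_mem (nhdsWithin_mono _ (fun y hy => hy.1) ht) self_mem_nhdsWithin)
  simpa using h0

/-- A convex function is differentiable at almost every point where it is finite. -/
lemma IsConvex.ae_isDiffAt (hφ : IsConvex φ) :
    ∀ᵐ x ∂(volume : Measure (Rd d)), φ x < ⊤ → IsDiffAt φ x := by
  have h1 := hφ.convexOn_interior.ae_differentiableAt volume isOpen_interior
  -- The boundary of a convex set is Lebesgue null, so almost every point of finiteness is interior.
  have h2 : ∀ᵐ x ∂(volume : Measure (Rd d)), x ∉ frontier (dom φ) :=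
    measure_eq_zero_iff_ae_notMem.1 (hφ.convexOn.1.addHaar_frontier volume)
  filter_upwards [h1, h2] with x hx1 hx2 hx
  have hxi : x ∈ interior (dom φ) := by
    by_contra hn
    exact hx2 ⟨subset_closure hx.ne, hn⟩
  refine ⟨?_, hx1 hxi⟩
  filter_upwards [isOpen_interior.mem_nhds hxi] with z hz
  exact ⟨hφ.ne_bot z, interior_subset hz⟩

lemma hasGradientAt_grad {x : Rd d} (h : IsDiffAt φ x) :
    HasGradientAt (fun z => (φ z).toReal) (grad φ x) x :=
  h.2.hasGradientAt

lemma measurable_grad (φ : Rd d → EReal) : Measurable (grad φ) := by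
  unfold grad gradient
  exact (LinearIsometryEquiv.continuous _).measurable.comp (measurable_fderiv ℝ _)

lemma measurableSet_isDiffAt (φ : Rd d → EReal) : MeasurableSet {x | IsDiffAt φ x} := by
  have : {x | IsDiffAt φ x} = interior {z | φ z ≠ ⊥ ∧ φ z ≠ ⊤} ∩
      {x | DifferentiableAt ℝ (fun z => (φ z).toReal) x} := by
    ext x
    simp [IsDiffAt, mem_interior_iff_mem_nhds, Filter.Eventually]
  rw [this]
  exact isOpen_interior.measurableSet.inter (measurableSet_of_differentiableAt ℝ _)

/-- The gradient of a convex function is a subgradient. -/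
lemma IsConvex.grad_le (hφ : IsConvex φ) {x z : Rd d} (hx : IsDiffAt φ x) (hz : z ∈ dom φ) :
    (φ x).toReal + inner ℝ (z - x) (grad φ x) ≤ (φ z).toReal := by
  have hxd : x ∈ dom φ := interior_subset hx.mem_interior_dom
  set f : Rd d → ℝ := fun w => (φ w).toReal
  have hd : HasDerivAt (fun t : ℝ => f (x + t • (z - x))) (inner ℝ (grad φ x) (z - x)) 0 := by
    have h1 : HasFDerivAt f (InnerProductSpace.toDual ℝ _ (grad φ x)) (x + (0 : ℝ) • (z - x)) := by
      simpa using (hasGradientAt_grad hx).hasFDerivAt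
    have h2 : HasDerivAt (fun t : ℝ => x + t • (z - x)) (z - x) 0 := by
      simpa using ((hasDerivAt_id (0 : ℝ)).smul_const (z - x)).const_add x
    exact h1.comp_hasDerivAt (0 : ℝ) h2
  have hlim := hd.tendsto_slope_zero_right
  -- Convexity bounds the slopes along the segment from `x` to `z` by `f z - f x`; their limit is
  -- the directional derivative.
  have hle : ∀ᶠ t : ℝ in 𝓝[>] 0,
      t⁻¹ • (f (x + (0 + t) • (z - x)) - f (x + (0 : ℝ) • (z - x))) ≤ f z - f x := by
    filter_upwards [Ioc_mem_nhdsGT (zero_lt_one (α := ℝ))] with t ht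
    have := hφ.convexOn.2 hxd hz (sub_nonneg.2 ht.2) ht.1.le (sub_add_cancel 1 t)
    have e : (1 - t) • x + t • z = x + (0 + t) • (z - x) := by module
    rw [e] at this
    simp only [smul_eq_mul, zero_smul, add_zero] at this ⊢
    rw [inv_mul_le_iff₀ ht.1]
    change f _ ≤ (1 - t) * f x + t * f z at this
    linarith
  have := le_of_tendsto hlim hle
  rw [real_inner_comm] at this
  change f x + _ ≤ f z
  linarith

/-- A subgradient at a point of differentiability is the gradient. -/
lemma IsDiffAt.eq_grad {x y : Rd d} (hx : IsDiffAt φ x)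
    (h : ∀ᶠ z in 𝓝 x, (φ x).toReal + inner ℝ (z - x) y ≤ (φ z).toReal) : y = grad φ x := by
  have h1 : HasFDerivAt (fun z => (φ z).toReal - inner ℝ y z)
      (InnerProductSpace.toDual ℝ _ (grad φ x) - InnerProductSpace.toDual ℝ _ y) x := by
    refine (hasGradientAt_grad hx).hasFDerivAt.sub ?_
    exact (InnerProductSpace.toDual ℝ (Rd d) y).hasFDerivAt
  have h2 : IsLocalMin (fun z => (φ z).toReal - inner ℝ y z) x := by
    filter_upwards [h] with z hz
    rw [inner_sub_left, real_inner_comm y z, real_inner_comm y x] at hz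
    linarith
  have h3 := h2.hasFDerivAt_eq_zero h1
  exact ((InnerProductSpace.toDual ℝ (Rd d)).injective (sub_eq_zero.1 h3)).symm

end OT

/-! ### Couplings and Fenchel–Young duality -/

namespace OT

open Set Filter Topology

variable {d : ℕ} {μ ν : Measure (Rd d)} {γ γ' : Measure (Rd d × Rd d)} {ψ : Rd d → EReal}

lemma measurePreserving_fst (hγ : γ ∈ couplings μ ν) : MeasurePreserving Prod.fst γ μ :=
  ⟨measurable_fst, hγ.1⟩

lemma measurePreserving_snd (hγ : γ ∈ couplings μ ν) : MeasurePreserving Prod.snd γ ν :=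
  ⟨measurable_snd, hγ.2⟩

lemma isProbabilityMeasure_of_mem_couplings (hμ : μ ∈ P2 d) (hγ : γ ∈ couplings μ ν) :
    IsProbabilityMeasure γ := by
  have := hμ.1
  refine ⟨?_⟩
  rw [← (measurePreserving_fst hγ).measure_preimage MeasurableSet.univ.nullMeasurableSet
    |>.trans measure_univ, preimage_univ]

lemma memLp_two_of_mem_P2 (hμ : μ ∈ P2 d) : MemLp (fun x : Rd d => x) 2 μ := by
  refine ⟨measurable_id.aestronglyMeasurable, ?_⟩
  rw [eLpNorm_lt_top_iff_lintegral_rpow_enorm_lt_top (by norm_num) (by norm_num)]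
  simpa using hμ.2

lemma memLp_fst (hμ : μ ∈ P2 d) (hγ : γ ∈ couplings μ ν) :
    MemLp (fun z : Rd d × Rd d => z.1) 2 γ :=
  (memLp_two_of_mem_P2 hμ).comp_measurePreserving (measurePreserving_fst hγ)

lemma memLp_snd (hν : ν ∈ P2 d) (hγ : γ ∈ couplings μ ν) :
    MemLp (fun z : Rd d × Rd d => z.2) 2 γ :=
  (memLp_two_of_mem_P2 hν).comp_measurePreserving (measurePreserving_snd hγ)

lemma integrable_sq_dist (hμ : μ ∈ P2 d) (hν : ν ∈ P2 d) (hγ : γ ∈ couplings μ ν) :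
    Integrable (fun z : Rd d × Rd d => ‖z.1 - z.2‖ ^ 2) γ :=
  ((memLp_fst hμ hγ).sub (memLp_snd hν hγ)).integrable_norm_pow (by norm_num)

lemma integrable_inner (hμ : μ ∈ P2 d) (hν : ν ∈ P2 d) (hγ : γ ∈ couplings μ ν) :
    Integrable (fun z : Rd d × Rd d => inner ℝ z.1 z.2) γ := by
  have h1 := (memLp_fst hμ hγ).integrable_norm_pow (by norm_num)
  have h2 := (memLp_snd hν hγ).integrable_norm_pow (by norm_num)
  refine (((h1.add h2).sub (integrable_sq_dist hμ hν hγ)).div_const 2).congr ?_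
  filter_upwards with z
  simp only [Pi.add_apply, Pi.sub_apply]
  rw [norm_sub_sq_real]
  ring

lemma cost_eq_ofReal (hμ : μ ∈ P2 d) (hν : ν ∈ P2 d) (hγ : γ ∈ couplings μ ν) :
    cost γ = ENNReal.ofReal (∫ z, ‖z.1 - z.2‖ ^ 2 ∂γ) := by
  rw [ofReal_integral_eq_lintegral_ofReal (integrable_sq_dist hμ hν hγ)
    (Eventually.of_forall fun z => by positivity)]
  refine lintegral_congr fun z => ?_
  rw [ENNReal.ofReal_pow (norm_nonneg _), ofReal_norm]

/-- The Legendre transform of `ψ`, the supremum being restricted to the interior of the domain. -/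
noncomputable def conj (ψ : Rd d → EReal) (y : Rd d) : EReal :=
  ⨆ x ∈ interior (dom ψ), ((inner ℝ x y - (ψ x).toReal : ℝ) : EReal)

lemma measurable_conj (ψ : Rd d → EReal) : Measurable (conj ψ) := by
  refine LowerSemicontinuous.measurable (lowerSemicontinuous_biSup fun x _ => ?_)
  refine Continuous.lowerSemicontinuous ?_
  exact continuous_coe_real_ereal.comp (by fun_prop)

lemma le_conj {x : Rd d} (hx : x ∈ interior (dom ψ)) (y : Rd d) :
    ((inner ℝ x y - (ψ x).toReal : ℝ) : EReal) ≤ conj ψ y :=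
  le_iSup₂ (f := fun x (_ : x ∈ interior (dom ψ)) =>
    ((inner ℝ x y - (ψ x).toReal : ℝ) : EReal)) x hx

/-- The Fenchel–Young inequality. The point `x` rules out the value `⊥`, which the supremum takes
when the domain has empty interior. -/
lemma inner_le_add_conj {x y : Rd d} (hx : x ∈ interior (dom ψ)) (hy : conj ψ y ≠ ⊤) :
    inner ℝ x y ≤ (ψ x).toReal + (conj ψ y).toReal := by
  have h := le_conj hx y
  have hb : conj ψ y ≠ ⊥ := ne_bot_of_le_ne_bot (EReal.coe_ne_bot _) h
  rw [← EReal.coe_toReal hy hb, EReal.coe_le_coe_iff] at h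
  linarith

/-- Equality in Fenchel–Young: by the gradient inequality, the supremum is attained at `x`. -/
lemma IsConvex.conj_grad (hψ : IsConvex ψ) {x : Rd d} (hx : IsDiffAt ψ x) :
    conj ψ (grad ψ x) = ((inner ℝ x (grad ψ x) - (ψ x).toReal : ℝ) : EReal) := by
  refine le_antisymm (iSup₂_le fun z hz => ?_) (le_conj hx.mem_interior_dom _)
  have := hψ.grad_le hx (interior_subset hz)
  rw [inner_sub_left] at this
  rw [EReal.coe_le_coe_iff]
  linarith

/-- Given equality at `(x, y)`, Fenchel–Young at nearby `z` becomes the subgradient inequality for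
`y`. -/
lemma IsDiffAt.eq_grad_of_conj {x y : Rd d} (hx : IsDiffAt ψ x) (hy : conj ψ y ≠ ⊤)
    (h : (ψ x).toReal + (conj ψ y).toReal = inner ℝ x y) : y = grad ψ x := by
  refine hx.eq_grad ?_
  filter_upwards [isOpen_interior.mem_nhds hx.mem_interior_dom] with z hz
  have := inner_le_add_conj hz hy
  rw [inner_sub_left]
  linarith

lemma aestronglyMeasurable_toReal (hψ : IsConvex ψ) (hd : ∀ᵐ x ∂μ, IsDiffAt ψ x) :
    AEStronglyMeasurable (fun x => (ψ x).toReal) μ := by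
  have h := hψ.convexOn_interior.continuousOn isOpen_interior
  have h2 := h.aestronglyMeasurable (μ := μ) isOpen_interior.measurableSet
  rwa [Measure.restrict_eq_self_of_ae_mem (hd.mono fun x hx => hx.mem_interior_dom)] at h2

/-- A coupling carried by the graph of the gradient of a convex function has an integrable
potential and an integrable conjugate potential. -/
lemma integrable_potentials (hμ : μ ∈ P2 d) (hν : ν ∈ P2 d) (hψ : IsConvex ψ)
    (hd : ∀ᵐ x ∂μ, IsDiffAt ψ x) (hγ : γ ∈ couplings μ ν)
    (hg : ∀ᵐ z ∂γ, z.2 = grad ψ z.1) :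
    Integrable (fun x => (ψ x).toReal) μ ∧ Integrable (fun y => (conj ψ y).toReal) ν ∧
      (∀ᵐ y ∂ν, conj ψ y ≠ ⊤) ∧
      ∀ᵐ z ∂γ, (ψ z.1).toReal + (conj ψ z.2).toReal = inner ℝ z.1 z.2 := by
  have := isProbabilityMeasure_of_mem_couplings hμ hγ
  have hp1 := measurePreserving_fst hγ
  have hp2 := measurePreserving_snd hγ
  have hdγ : ∀ᵐ z ∂γ, IsDiffAt ψ z.1 := hp1.quasiMeasurePreserving.ae hd
  have hval : ∀ᵐ z ∂γ, conj ψ z.2 = ((inner ℝ z.1 z.2 - (ψ z.1).toReal : ℝ) : EReal) := by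
    filter_upwards [hdγ, hg] with z hz1 hz2
    rw [hz2, hψ.conj_grad hz1]
  have heq : ∀ᵐ z ∂γ, (ψ z.1).toReal + (conj ψ z.2).toReal = inner ℝ z.1 z.2 := by
    filter_upwards [hval] with z hz
    rw [hz, EReal.toReal_coe]
    ring
  have hfinγ : ∀ᵐ z ∂γ, conj ψ z.2 ≠ ⊤ := hval.mono fun z hz => hz ▸ EReal.coe_ne_top _
  have hms : MeasurableSet {y | conj ψ y ≠ ⊤} :=
    (measurable_conj ψ (measurableSet_singleton ⊤)).compl
  have hfin : ∀ᵐ y ∂ν, conj ψ y ≠ ⊤ := by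
    rw [← hγ.2, ae_map_iff measurable_snd.aemeasurable hms]
    exact hfinγ
  -- One good pair controls everything: Fenchel–Young with `y₀` bounds `ψ` below by an affine
  -- function, and with `x₀` it bounds the conjugate below, hence `ψ x = ⟪x, y⟫ - ψ* y` above.
  obtain ⟨⟨x₀, y₀⟩, hx₀, hy₀⟩ := (hdγ.and hfinγ).exists
  simp only at hx₀ hy₀
  have hsm : AEStronglyMeasurable (fun z : Rd d × Rd d => (ψ z.1).toReal) γ :=
    (aestronglyMeasurable_toReal hψ hd).comp_measurePreserving hp1
  have hI1 : Integrable (fun z : Rd d × Rd d => (ψ z.1).toReal) γ := by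
    have hlo : Integrable (fun z : Rd d × Rd d => inner ℝ z.1 y₀ - (conj ψ y₀).toReal) γ :=
      (((memLp_fst hμ hγ).integrable (by norm_num)).inner_const y₀).sub (integrable_const _)
    have hhi : Integrable (fun z : Rd d × Rd d =>
        inner ℝ z.1 z.2 - (inner ℝ x₀ z.2 - (ψ x₀).toReal)) γ :=
      (integrable_inner hμ hν hγ).sub
        ((((memLp_snd hν hγ).integrable (by norm_num)).const_inner x₀).sub (integrable_const _))
    refine integrable_of_le_of_le hsm ?_ ?_ hlo hhi
    · filter_upwards [hdγ] with z hz
      have := inner_le_add_conj hz.mem_interior_dom hy₀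
      linarith
    · filter_upwards [heq, hfinγ] with z hz hz2
      have := inner_le_add_conj hx₀.mem_interior_dom hz2
      linarith
  have hI2 : Integrable (fun z : Rd d × Rd d => (conj ψ z.2).toReal) γ := by
    refine ((integrable_inner hμ hν hγ).sub hI1).congr ?_
    filter_upwards [heq] with z hz
    simp only [Pi.sub_apply]
    linarith
  refine ⟨?_, ?_, hfin, heq⟩
  · exact (hp1.integrable_comp (aestronglyMeasurable_toReal hψ hd)).1 hI1
  · exact (hp2.integrable_comp (measurable_conj ψ).ereal_toReal.aestronglyMeasurable).1 hI2

/-- A coupling carried by the graph of the gradient of a convex function has least cost, and every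
coupling of no greater cost is carried by the same graph. -/
theorem cost_le_of_grad (hμ : μ ∈ P2 d) (hν : ν ∈ P2 d) (hψ : IsConvex ψ)
    (hd : ∀ᵐ x ∂μ, IsDiffAt ψ x) (hγ : γ ∈ couplings μ ν)
    (hg : ∀ᵐ z ∂γ, z.2 = grad ψ z.1) (hγ' : γ' ∈ couplings μ ν) :
    cost γ ≤ cost γ' ∧ (cost γ' ≤ cost γ → ∀ᵐ z ∂γ', z.2 = grad ψ z.1) := by
  obtain ⟨hI1, hI2, hfin, heq⟩ := integrable_potentials hμ hν hψ hd hγ hg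
  have hJ1 : Integrable (fun x : Rd d => ‖x‖ ^ 2 - 2 * (ψ x).toReal) μ :=
    ((memLp_two_of_mem_P2 hμ).integrable_norm_pow (by norm_num)).sub (hI1.const_mul 2)
  have hJ2 : Integrable (fun y : Rd d => ‖y‖ ^ 2 - 2 * (conj ψ y).toReal) ν :=
    ((memLp_two_of_mem_P2 hν).integrable_norm_pow (by norm_num)).sub (hI2.const_mul 2)
  -- Dual potentials for the quadratic cost: `a x + b y ≤ ‖x - y‖ ^ 2` is Fenchel–Young doubled.
  set a := fun x : Rd d => ‖x‖ ^ 2 - 2 * (ψ x).toReal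
  set b := fun y : Rd d => ‖y‖ ^ 2 - 2 * (conj ψ y).toReal
  have hab : ∀ ρ ∈ couplings μ ν, Integrable (fun z : Rd d × Rd d => a z.1 + b z.2) ρ ∧
      ∫ z, (a z.1 + b z.2) ∂ρ = ∫ x, a x ∂μ + ∫ y, b y ∂ν := by
    intro ρ hρ
    have h1 : Integrable (fun z : Rd d × Rd d => a z.1) ρ :=
      (measurePreserving_fst hρ).integrable_comp_of_integrable hJ1
    have h2 : Integrable (fun z : Rd d × Rd d => b z.2) ρ :=
      (measurePreserving_snd hρ).integrable_comp_of_integrable hJ2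
    refine ⟨h1.add h2, ?_⟩
    rw [integral_add h1 h2]
    congr 1
    · rw [← hρ.1, integral_map measurable_fst.aemeasurable]
      rw [hρ.1]; exact hJ1.aestronglyMeasurable
    · rw [← hρ.2, integral_map measurable_snd.aemeasurable]
      rw [hρ.2]; exact hJ2.aestronglyMeasurable
  have hcost : ∫ z, ‖z.1 - z.2‖ ^ 2 ∂γ = ∫ x, a x ∂μ + ∫ y, b y ∂ν := by
    rw [← (hab γ hγ).2]
    refine integral_congr_ae ?_
    filter_upwards [heq] with z hz
    simp only [a, b, norm_sub_sq_real]
    linarith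
  have hdγ' : ∀ᵐ z ∂γ', IsDiffAt ψ z.1 :=
    (measurePreserving_fst hγ').quasiMeasurePreserving.ae hd
  have hfin' : ∀ᵐ z ∂γ', conj ψ z.2 ≠ ⊤ :=
    (measurePreserving_snd hγ').quasiMeasurePreserving.ae hfin
  have hle : ∀ᵐ z ∂γ', a z.1 + b z.2 ≤ ‖z.1 - z.2‖ ^ 2 := by
    filter_upwards [hdγ', hfin'] with z hz1 hz2
    have := inner_le_add_conj hz1.mem_interior_dom hz2
    simp only [a, b, norm_sub_sq_real]
    linarith
  have hD := integrable_sq_dist hμ hν hγ'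
  rw [cost_eq_ofReal hμ hν hγ, cost_eq_ofReal hμ hν hγ', hcost, ← (hab γ' hγ').2]
  refine ⟨ENNReal.ofReal_le_ofReal (integral_mono_ae (hab γ' hγ').1 hD hle), fun hc => ?_⟩
  have hc' : ∫ z, ‖z.1 - z.2‖ ^ 2 ∂γ' ≤ ∫ z, (a z.1 + b z.2) ∂γ' := by
    rw [(hab γ' hγ').2, ← hcost] at hc ⊢
    rwa [ENNReal.ofReal_le_ofReal_iff (integral_nonneg fun z => by positivity)] at hc
  -- The nonnegative gap has integral zero, so Fenchel–Young is an equality almost everywhere.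
  have hzero : ∫ z, (‖z.1 - z.2‖ ^ 2 - (a z.1 + b z.2)) ∂γ' = 0 := by
    rw [integral_sub hD (hab γ' hγ').1]
    linarith [integral_mono_ae (hab γ' hγ').1 hD hle]
  rw [integral_eq_zero_iff_of_nonneg_ae (hle.mono fun z hz => sub_nonneg.2 hz)
    (hD.sub (hab γ' hγ').1)] at hzero
  filter_upwards [hzero, hdγ', hfin'] with z hz hz1 hz2
  refine hz1.eq_grad_of_conj hz2 ?_
  simp only [a, b, norm_sub_sq_real, Pi.zero_apply] at hz
  linarith

/-- A coupling carried by the graph of a measurable map is the law of the graph map. -/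
lemma eq_map_of_ae_eq_snd {T : Rd d → Rd d} (hT : Measurable T) (hγ : γ ∈ couplings μ ν)
    (h : ∀ᵐ z ∂γ, z.2 = T z.1) : γ = μ.map (fun x => (x, T x)) := by
  rw [← hγ.1, Measure.map_map (by fun_prop) measurable_fst]
  conv_lhs => rw [← Measure.map_id (μ := γ)]
  refine Measure.map_congr ?_
  filter_upwards [h] with z hz
  exact Prod.ext rfl hz

lemma isOptimalCoupling_of_le (hγ : γ ∈ couplings μ ν)
    (h : ∀ γ' ∈ couplings μ ν, cost γ ≤ cost γ') : IsOptimalCoupling μ ν γ := by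
  refine ⟨hγ, ⟨mem_image_of_mem _ hγ, ?_⟩, ?_⟩
  · rintro _ ⟨γ', hγ', rfl⟩
    exact h γ' hγ'
  · have : W2 μ ν = cost γ ^ (1 / 2 : ℝ) :=
      le_antisymm (iInf₂_le γ hγ)
        (le_iInf₂ fun γ' hγ' => ENNReal.rpow_le_rpow (h γ' hγ') (by norm_num))
    rw [this, ← ENNReal.rpow_natCast, ← ENNReal.rpow_mul]
    norm_num

end OT

/-! ### Cyclic monotonicity and Rockafellar's potential -/

namespace OT

open Set Filter Topology

variable {d : ℕ} {S : Set (Rd d × Rd d)}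

/-- A set of pairs is cyclically monotone if, for finitely many of its points, no rearrangement
of the first components increases the sum of the inner products. -/
def CyclicallyMonotone (S : Set (Rd d × Rd d)) : Prop :=
  ∀ (n : ℕ) (z : Fin n → Rd d × Rd d), (∀ i, z i ∈ S) → ∀ σ : Equiv.Perm (Fin n),
    ∑ i, inner ℝ (z (σ i)).1 (z i).2 ≤ ∑ i, inner ℝ (z i).1 (z i).2

/-- The increment along the first `n` steps of a chain of pairs, followed by a step to `x`. -/
noncomputable def chainSum (n : ℕ) (z : ℕ → Rd d × Rd d) (x : Rd d) : ℝ :=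
  ∑ i ∈ Finset.range n, inner ℝ ((z (i + 1)).1 - (z i).1) (z i).2 + inner ℝ (x - (z n).1) (z n).2

/-- The chains in `S` of a given length that start at `p`. -/
def chains (S : Set (Rd d × Rd d)) (p : Rd d × Rd d) (n : ℕ) : Set (ℕ → Rd d × Rd d) :=
  {z | z 0 = p ∧ ∀ i ≤ n, z i ∈ S}

/-- Rockafellar's potential of a set of pairs. -/
noncomputable def rockafellar (S : Set (Rd d × Rd d)) (p : Rd d × Rd d) (x : Rd d) : EReal :=
  ⨆ (n : ℕ) (z ∈ chains S p n), (chainSum n z x : EReal)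

/-- Returning to `p` closes the chain into a cycle of `n + 1` points, to which the rotation applies.
-/
lemma CyclicallyMonotone.chainSum_nonpos (hS : CyclicallyMonotone S) {p : Rd d × Rd d} {n : ℕ}
    {z : ℕ → Rd d × Rd d} (hz : z ∈ chains S p n) : chainSum n z p.1 ≤ 0 := by
  have h := hS (n + 1) (fun i => z i) (fun i => hz.2 i (Nat.lt_succ_iff.1 i.2)) (finRotate (n + 1))
  rw [Fin.sum_univ_castSucc, Fin.sum_univ_castSucc] at h
  have e1 : ∀ i : Fin n, ((finRotate (n + 1) i.castSucc : Fin (n + 1)) : ℕ) = i + 1 := fun i =>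
    coe_finRotate_of_ne_last (Fin.castSucc_lt_last i).ne
  simp only [e1, finRotate_last, Fin.val_castSucc, Fin.val_last, Fin.val_zero, hz.1] at h
  rw [chainSum, Finset.sum_range (fun i => inner ℝ ((z (i + 1)).1 - (z i).1) (z i).2)]
  simp only [inner_sub_left, Finset.sum_sub_distrib]
  linarith

lemma le_rockafellar {p : Rd d × Rd d} {n : ℕ} {z : ℕ → Rd d × Rd d} (hz : z ∈ chains S p n)
    (x : Rd d) : (chainSum n z x : EReal) ≤ rockafellar S p x :=
  le_iSup_of_le n (le_iSup₂_of_le z hz le_rfl)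

lemma rockafellar_ne_bot {p : Rd d × Rd d} (hp : p ∈ S) (x : Rd d) : rockafellar S p x ≠ ⊥ :=
  ne_bot_of_le_ne_bot (EReal.coe_ne_bot _)
    (le_rockafellar (n := 0) (z := fun _ => p) ⟨rfl, fun _ _ => hp⟩ x)

lemma CyclicallyMonotone.rockafellar_self_le (hS : CyclicallyMonotone S) (p : Rd d × Rd d) :
    rockafellar S p p.1 ≤ 0 :=
  iSup_le fun _ => iSup₂_le fun _ hz => EReal.coe_nonpos.2 (hS.chainSum_nonpos hz)

/-- The pairs of `S` are subgradients of Rockafellar's potential. -/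
lemma rockafellar_add_le {p q : Rd d × Rd d} (hq : q ∈ S) (x : Rd d) :
    rockafellar S p q.1 + ((inner ℝ (x - q.1) q.2 : ℝ) : EReal) ≤ rockafellar S p x := by
  rw [← EReal.le_sub_iff_add_le (Or.inl (EReal.coe_ne_bot _)) (Or.inl (EReal.coe_ne_top _))]
  refine iSup_le fun n => iSup₂_le fun z hz => ?_
  rw [EReal.le_sub_iff_add_le (Or.inl (EReal.coe_ne_bot _)) (Or.inl (EReal.coe_ne_top _)),
    ← EReal.coe_add]
  -- Appending `q` turns the final step to `q.1` into an inner one and adds the final term `⟪x -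
  -- q.1, q.2⟫`.
  have hz' : Function.update z (n + 1) q ∈ chains S p (n + 1) := by
    refine ⟨by rw [Function.update_of_ne (by omega)]; exact hz.1, fun i hi => ?_⟩
    rcases eq_or_ne i (n + 1) with rfl | h
    · simpa using hq
    · rw [Function.update_of_ne h]
      exact hz.2 i (by omega)
  refine le_trans (le_of_eq ?_) (le_rockafellar hz' x)
  congr 1
  have hu : ∀ i ≤ n, Function.update z (n + 1) q i = z i := fun i hi =>
    Function.update_of_ne (by omega) _ _
  rw [chainSum, chainSum, Finset.sum_range_succ, hu n le_rfl, Function.update_self]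
  congr 2
  refine Finset.sum_congr rfl fun i hi => ?_
  have := Finset.mem_range.1 hi
  rw [hu i this.le, hu (i + 1) this]

lemma chainSum_combo (n : ℕ) (z : ℕ → Rd d × Rd d) (x y : Rd d) (t : ℝ) :
    chainSum n z ((1 - t) • x + t • y) = (1 - t) * chainSum n z x + t * chainSum n z y := by
  simp only [chainSum, inner_sub_left, inner_add_left, real_inner_smul_left]
  ring

lemma CyclicallyMonotone.isConvex_rockafellar (hS : CyclicallyMonotone S) {p : Rd d × Rd d}
    (hp : p ∈ S) : IsConvex (rockafellar S p) := by
  refine ⟨rockafellar_ne_bot hp,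
    ⟨p.1, ne_top_of_le_ne_top EReal.zero_ne_top (hS.rockafellar_self_le p)⟩, ?_⟩
  intro x y t ht0 ht1
  refine iSup_le fun n => iSup₂_le fun z hz => ?_
  rw [chainSum_combo, EReal.coe_add, EReal.coe_mul, EReal.coe_mul]
  exact add_le_add
    (mul_le_mul_of_nonneg_left (le_rockafellar hz x) (EReal.coe_nonneg.2 (sub_nonneg.2 ht1)))
    (mul_le_mul_of_nonneg_left (le_rockafellar hz y) (EReal.coe_nonneg.2 ht0))

/-- The subgradient inequality at `q`, read at `p.1` where the potential is at most zero, bounds its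
value at `q.1`. -/
lemma CyclicallyMonotone.rockafellar_lt_top (hS : CyclicallyMonotone S) {p q : Rd d × Rd d}
    (hq : q ∈ S) : rockafellar S p q.1 < ⊤ := by
  have h := (rockafellar_add_le hq p.1).trans (hS.rockafellar_self_le p)
  by_contra hc
  rw [not_lt_top_iff] at hc
  rw [hc, EReal.top_add_coe] at h
  exact absurd h (by simp)

/-- Where Rockafellar's potential is differentiable, its gradient is given by the pairs of `S`. -/
lemma CyclicallyMonotone.eq_grad_rockafellar (hS : CyclicallyMonotone S) {p q : Rd d × Rd d}
    (hp : p ∈ S) (hq : q ∈ S) (hd : IsDiffAt (rockafellar S p) q.1) :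
    q.2 = grad (rockafellar S p) q.1 := by
  have hc := hS.isConvex_rockafellar hp
  refine hd.eq_grad ?_
  filter_upwards [isOpen_interior.mem_nhds hd.mem_interior_dom] with x hx
  have h := rockafellar_add_le (p := p) hq x
  rw [← hc.coe_toReal (interior_subset hx), ← hc.coe_toReal (hS.rockafellar_lt_top hq).ne] at h
  exact_mod_cast h

end OT

/-! ### Optimal couplings: existence and cyclically monotone support -/

namespace OT

open Set Filter Topology

variable {d : ℕ} {μ ν : Measure (Rd d)} {γ : Measure (Rd d × Rd d)}

/-- The cost is the supremum of integrals of bounded continuous truncations, each weakly continuous.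
-/
lemma lowerSemicontinuous_cost :
    LowerSemicontinuous fun γ : ProbabilityMeasure (Rd d × Rd d) =>
      cost (γ : Measure (Rd d × Rd d)) := by
  let f : ℕ → BoundedContinuousFunction (Rd d × Rd d) NNReal := fun n =>
    BoundedContinuousFunction.mkOfBound ⟨fun z => min (‖z.1 - z.2‖₊ ^ 2) n, by fun_prop⟩ n
      fun x y => by
        have h : ∀ x : Rd d × Rd d, min (‖x.1 - x.2‖₊ ^ 2) (n : NNReal) ≤ n :=
          fun _ => min_le_right _ _
        rw [NNReal.dist_eq, abs_le]
        have hx : ((min (‖x.1 - x.2‖₊ ^ 2) (n : NNReal) : NNReal) : ℝ) ≤ n := by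
          exact_mod_cast h x
        have hy : ((min (‖y.1 - y.2‖₊ ^ 2) (n : NNReal) : NNReal) : ℝ) ≤ n := by
          exact_mod_cast h y
        simp only [ContinuousMap.coe_mk]
        constructor <;> linarith [NNReal.coe_nonneg (min (‖x.1 - x.2‖₊ ^ 2) (n : NNReal)),
          NNReal.coe_nonneg (min (‖y.1 - y.2‖₊ ^ 2) (n : NNReal))]
  have hf : ∀ γ : ProbabilityMeasure (Rd d × Rd d),
      cost (γ : Measure (Rd d × Rd d)) =
        ⨆ n, ∫⁻ z, (f n z : ℝ≥0∞) ∂(γ : Measure (Rd d × Rd d)) := by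
    intro γ
    rw [cost, ← lintegral_iSup (fun n => by fun_prop)]
    · refine lintegral_congr fun z => ?_
      have : ∀ n, (f n z : ℝ≥0∞) = min (‖z.1 - z.2‖ₑ ^ 2) n := by
        intro n
        change ((min (‖z.1 - z.2‖₊ ^ 2) (n : NNReal) : NNReal) : ℝ≥0∞) = _
        rw [ENNReal.coe_min, ENNReal.coe_pow, ENNReal.coe_natCast]
        rfl
      simp_rw [this]
      rw [← inf_iSup_eq, ENNReal.iSup_natCast, inf_top_eq]
    · intro m n hmn z
      change ((min (‖z.1 - z.2‖₊ ^ 2) (m : NNReal) : NNReal) : ℝ≥0∞) ≤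
        ((min (‖z.1 - z.2‖₊ ^ 2) (n : NNReal) : NNReal) : ℝ≥0∞)
      gcongr
  simp_rw [hf]
  exact lowerSemicontinuous_iSup fun n =>
    (ProbabilityMeasure.continuous_lintegral_boundedContinuousFunction (f n)).lowerSemicontinuous

/-- An optimal coupling exists. -/
theorem exists_cost_le (μ ν : Measure (Rd d)) [IsProbabilityMeasure μ] [IsProbabilityMeasure ν] :
    ∃ γ ∈ couplings μ ν, ∀ γ' ∈ couplings μ ν, cost γ ≤ cost γ' := by
  let C : Set (ProbabilityMeasure (Rd d × Rd d)) := {γ | (γ : Measure _) ∈ couplings μ ν}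
  have hC : IsClosed C := by
    have h1 : IsClosed {γ : ProbabilityMeasure (Rd d × Rd d) |
        γ.map continuous_fst.measurable.aemeasurable =
          (⟨μ, inferInstance⟩ : ProbabilityMeasure _)} :=
      isClosed_eq (ProbabilityMeasure.continuous_map continuous_fst) continuous_const
    have h2 : IsClosed {γ : ProbabilityMeasure (Rd d × Rd d) |
        γ.map continuous_snd.measurable.aemeasurable =
          (⟨ν, inferInstance⟩ : ProbabilityMeasure _)} :=
      isClosed_eq (ProbabilityMeasure.continuous_map continuous_snd) continuous_const
    convert h1.inter h2 using 1
    ext γ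
    refine and_congr ⟨fun h => ?_, fun h => ?_⟩ ⟨fun h => ?_, fun h => ?_⟩
    · exact Subtype.ext h
    · exact congrArg Subtype.val h
    · exact Subtype.ext h
    · exact congrArg Subtype.val h
  -- Fixed marginals make the couplings tight, so Prokhorov's theorem gives compactness.
  have htight : IsTightMeasureSet
      {((γ : ProbabilityMeasure _) : Measure (Rd d × Rd d)) | γ ∈ C} := by
    refine IsTightMeasureSet.prodMk
      ((isTightMeasureSet_singleton (μ := μ)).subset ?_)
      ((isTightMeasureSet_singleton (μ := ν)).subset ?_)
    · rintro _ ⟨_, ⟨γ, hγ, rfl⟩, rfl⟩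
      exact hγ.1
    · rintro _ ⟨_, ⟨γ, hγ, rfl⟩, rfl⟩
      exact hγ.2
  have hcomp : IsCompact C := hC.closure_eq ▸ isCompact_closure_of_isTightMeasureSet htight
  have hne : C.Nonempty := ⟨⟨μ.prod ν, inferInstance⟩,
    show μ.prod ν ∈ couplings μ ν from
      ⟨by simp [Measure.map_fst_prod], by simp [Measure.map_snd_prod]⟩⟩
  obtain ⟨γ, hγ, hmin⟩ :=
    (lowerSemicontinuous_cost.lowerSemicontinuousOn C).exists_isMinOn hne hcomp
  refine ⟨γ, hγ, fun γ' hγ' => ?_⟩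
  have : IsProbabilityMeasure γ' := by
    refine ⟨?_⟩
    rw [← measure_univ (μ := μ), ← hγ'.1, Measure.map_apply measurable_fst MeasurableSet.univ,
      preimage_univ]
  exact hmin (a := (⟨γ', this⟩ : ProbabilityMeasure _)) hγ'

lemma cost_add (γ γ' : Measure (Rd d × Rd d)) : cost (γ + γ') = cost γ + cost γ' :=
  lintegral_add_measure _ _ _

lemma cost_smul (c : ℝ≥0∞) (γ : Measure (Rd d × Rd d)) : cost (c • γ) = c * cost γ :=
  lintegral_smul_measure _ _

lemma cost_sum {ι : Type*} [Fintype ι] (γ : ι → Measure (Rd d × Rd d)) :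
    cost (∑ i, γ i) = ∑ i, cost (γ i) :=
  lintegral_finsetSum_measure _ _ _

lemma cost_map {α : Type*} [MeasurableSpace α] {Q : Measure α} {f : α → Rd d × Rd d}
    (hf : Measurable f) : cost (Q.map f) = ∫⁻ a, ‖(f a).1 - (f a).2‖ₑ ^ 2 ∂Q :=
  lintegral_map (by fun_prop) hf

/-- Replacing a part of an optimal coupling by another measure with the same marginals does not
decrease the cost. -/
lemma cost_le_of_le [IsFiniteMeasure γ] (hγ : γ ∈ couplings μ ν)
    (hmin : ∀ γ' ∈ couplings μ ν, cost γ ≤ cost γ') (hfin : cost γ ≠ ∞)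
    {α β : Measure (Rd d × Rd d)} (hα : α ≤ γ) (h1 : α.map Prod.fst = β.map Prod.fst)
    (h2 : α.map Prod.snd = β.map Prod.snd) : cost α ≤ cost β := by
  have : IsFiniteMeasure α := isFiniteMeasure_of_le γ hα
  have hsub : γ - α + α = γ := Measure.sub_add_cancel_of_le hα
  have hmem : γ - α + β ∈ couplings μ ν := by
    refine ⟨?_, ?_⟩
    · rw [Measure.map_add _ _ measurable_fst, ← h1, ← Measure.map_add _ _ measurable_fst,
        hsub, hγ.1]
    · rw [Measure.map_add _ _ measurable_snd, ← h2, ← Measure.map_add _ _ measurable_snd,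
        hsub, hγ.2]
  have h := hmin _ hmem
  have hne : cost (γ - α) ≠ ∞ := by
    rw [← hsub, cost_add] at hfin
    exact (ENNReal.add_ne_top.1 hfin).1
  conv_lhs at h => rw [← hsub]
  rw [cost_add, cost_add] at h
  exact (ENNReal.add_le_add_iff_left hne).1 h

/-- The support of an optimal coupling of finite cost is cyclically monotone. -/
theorem cyclicallyMonotone_support [IsFiniteMeasure γ] (hγ : γ ∈ couplings μ ν)
    (hmin : ∀ γ' ∈ couplings μ ν, cost γ ≤ cost γ') (hfin : cost γ ≠ ∞) :
    CyclicallyMonotone γ.support := by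
  intro n z hz σ
  by_contra! hlt
  have hn : n ≠ 0 := by
    rintro rfl
    simp at hlt
  have : NeZero n := ⟨hn⟩
  let F : (Fin n → Rd d × Rd d) → ℝ := fun w => ∑ i, ‖(w (σ i)).1 - (w i).2‖ ^ 2
  let G : (Fin n → Rd d × Rd d) → ℝ := fun w => ∑ i, ‖(w i).1 - (w i).2‖ ^ 2
  have hFG : F z < G z := by
    simp only [F, G, norm_sub_sq_real, Finset.sum_add_distrib, Finset.sum_sub_distrib,
      ← Finset.mul_sum]
    rw [Equiv.sum_comp σ (fun i => ‖(z i).1‖ ^ 2)]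
    linarith
  have hopen : IsOpen {w | F w < G w} := isOpen_lt (by fun_prop) (by fun_prop)
  -- The strict inequality persists on a product of neighbourhoods, each of positive mass since its
  -- centre lies in the support.
  obtain ⟨A, hA, hAsub⟩ := isOpen_pi_iff'.1 hopen z hFG
  have hpos : ∀ i, γ (A i) ≠ 0 := fun i =>
    ((Measure.mem_support_iff_forall _).1 (hz i) _ ((hA i).1.mem_nhds (hA i).2)).ne'
  let κ : Fin n → Measure (Rd d × Rd d) := fun i => (γ (A i))⁻¹ • γ.restrict (A i)
  have hκ : ∀ i, IsProbabilityMeasure (κ i) := fun i =>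
    ⟨by simp [κ, ENNReal.inv_mul_cancel (hpos i) (measure_ne_top γ _)]⟩
  let Q := Measure.pi κ
  have hQ : ∀ i, Q.map (fun w => w i) = κ i := fun i => (measurePreserving_eval κ i).map_eq
  obtain ⟨j, -, hj⟩ := Finset.exists_min_image Finset.univ (fun i => γ (A i)) Finset.univ_nonempty
  -- The least mass divided by `n` makes each `c • κ i` at most `γ / n`, so that `α ≤ γ` even if the
  -- `A i` overlap.
  let c : ℝ≥0∞ := γ (A j) / n
  have hc0 : c ≠ 0 := ENNReal.div_ne_zero.2 ⟨hpos j, ENNReal.natCast_ne_top n⟩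
  have hctop : c ≠ ∞ := ENNReal.div_ne_top (measure_ne_top _ _) (by exact_mod_cast hn)
  let α : Measure (Rd d × Rd d) := c • ∑ i, κ i
  -- Under `Q` the points are drawn independently from the `κ i`; permuting their first components
  -- keeps both marginals of `α`.
  let β : Measure (Rd d × Rd d) := c • ∑ i, Q.map (fun w => ((w (σ i)).1, (w i).2))
  have hαγ : α ≤ γ := by
    have h1 : ∀ i, c • κ i ≤ (n : ℝ≥0∞)⁻¹ • γ := by
      intro i
      have hci : c * (γ (A i))⁻¹ ≤ (n : ℝ≥0∞)⁻¹ := by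
        calc c * (γ (A i))⁻¹ ≤ γ (A i) / n * (γ (A i))⁻¹ := by
              gcongr
              exact ENNReal.div_le_div_right (hj i (Finset.mem_univ i)) _
          _ = (n : ℝ≥0∞)⁻¹ * (γ (A i) * (γ (A i))⁻¹) := by
              rw [div_eq_mul_inv]; ring
          _ = _ := by rw [ENNReal.mul_inv_cancel (hpos i) (measure_ne_top _ _), mul_one]
      refine Measure.le_intro fun s _ _ => ?_
      simp only [κ, smul_smul, Measure.smul_apply, smul_eq_mul]
      gcongr
      exact Measure.restrict_le_self
    calc α = ∑ i, c • κ i := Finset.smul_sum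
      _ ≤ ∑ _i : Fin n, (n : ℝ≥0∞)⁻¹ • γ := Finset.sum_le_sum fun i _ => h1 i
      _ = γ := by
        rw [Finset.sum_const, Finset.card_univ, Fintype.card_fin, ← Nat.cast_smul_eq_nsmul ℝ≥0∞,
          smul_smul, ENNReal.mul_inv_cancel (by exact_mod_cast hn) (ENNReal.natCast_ne_top n),
          one_smul]
  have hmap : ∀ (g : Rd d × Rd d → Rd d), Measurable g → ∀ (θ : Fin n → Measure (Rd d × Rd d)),
      (c • ∑ i, θ i).map g = c • ∑ i, (θ i).map g := by
    intro g hg θ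
    rw [Measure.map_smul, ← Measure.mapₗ_apply_of_measurable hg, map_sum]
    simp_rw [Measure.mapₗ_apply_of_measurable hg]
  have hm1 : α.map Prod.fst = β.map Prod.fst := by
    rw [hmap _ measurable_fst, hmap _ measurable_fst, ← Equiv.sum_comp σ]
    congr 1
    refine Finset.sum_congr rfl fun i _ => ?_
    rw [← hQ, Measure.map_map measurable_fst (by fun_prop),
      Measure.map_map measurable_fst (by fun_prop)]
    rfl
  have hm2 : α.map Prod.snd = β.map Prod.snd := by
    rw [hmap _ measurable_snd, hmap _ measurable_snd]
    congr 1
    refine Finset.sum_congr rfl fun i _ => ?_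
    rw [← hQ, Measure.map_map measurable_snd (by fun_prop),
      Measure.map_map measurable_snd (by fun_prop)]
    rfl
  have hle := cost_le_of_le hγ hmin hfin hαγ hm1 hm2
  have hαfin : cost α ≠ ∞ := ne_top_of_le_ne_top hfin (lintegral_mono' hαγ le_rfl)
  have hcα : cost α = c * ∫⁻ w, ENNReal.ofReal (G w) ∂Q := by
    rw [cost_smul, cost_sum]
    congr 1
    have : ∀ i, Measurable fun w : Fin n → Rd d × Rd d => w i := by
      fun_prop
    simp_rw [← hQ, cost_map (this _)]
    rw [← lintegral_finsetSum _ (fun i _ => by fun_prop)]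
    refine lintegral_congr fun w => ?_
    rw [ENNReal.ofReal_sum_of_nonneg (fun i _ => by positivity)]
    simp_rw [ENNReal.ofReal_pow (norm_nonneg _), ofReal_norm]
  have hcβ : cost β = c * ∫⁻ w, ENNReal.ofReal (F w) ∂Q := by
    rw [cost_smul, cost_sum]
    congr 1
    have : ∀ i, Measurable fun w : Fin n → Rd d × Rd d => ((w (σ i)).1, (w i).2) := by
      fun_prop
    simp_rw [cost_map (this _)]
    rw [← lintegral_finsetSum _ (fun i _ => by fun_prop)]
    refine lintegral_congr fun w => ?_
    rw [ENNReal.ofReal_sum_of_nonneg (fun i _ => by positivity)]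
    simp_rw [ENNReal.ofReal_pow (norm_nonneg _), ofReal_norm]
  have hae : ∀ᵐ w ∂Q, F w < G w := by
    have h1 : ∀ᵐ w ∂Q, ∀ i, w i ∈ A i := by
      rw [ae_all_iff]
      intro i
      refine (measurePreserving_eval κ i).quasiMeasurePreserving.ae ?_
      exact Measure.ae_smul_measure (ae_restrict_mem (hA i).1.measurableSet) _
    filter_upwards [h1] with w hw
    exact hAsub (fun i _ => hw i)
  rw [hcα, hcβ, ENNReal.mul_le_mul_iff_right hc0 hctop] at hle
  have hGfin : ∫⁻ w, ENNReal.ofReal (G w) ∂Q ≠ ∞ := by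
    intro h
    rw [hcα, h, ENNReal.mul_top hc0] at hαfin
    exact hαfin rfl
  have hstrict : ∫⁻ w, ENNReal.ofReal (F w) ∂Q < ∫⁻ w, ENNReal.ofReal (G w) ∂Q := by
    refine lintegral_strict_mono (IsProbabilityMeasure.ne_zero Q) (by fun_prop)
      (ne_top_of_le_ne_top hGfin (lintegral_mono_ae (hae.mono fun w hw =>
        ENNReal.ofReal_le_ofReal hw.le))) ?_
    filter_upwards [hae] with w hw
    exact (ENNReal.ofReal_lt_ofReal_iff_of_nonneg (Finset.sum_nonneg fun i _ => by positivity)).2 hw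
  exact absurd hle hstrict.not_ge

/-- There is an optimal coupling carried by the graph of the gradient of a convex function. -/
theorem exists_isConvex_grad (hμ : μ ∈ P2 d) (hν : ν ∈ P2 d) (hdens : μ ≪ volume) :
    ∃ φ : Rd d → EReal, IsConvex φ ∧ (∀ᵐ x ∂μ, IsDiffAt φ x) ∧
      ∃ γ ∈ couplings μ ν, ∀ᵐ z ∂γ, z.2 = grad φ z.1 := by
  have := hμ.1
  have := hν.1
  obtain ⟨γ, hγ, hmin⟩ := exists_cost_le μ ν
  have := isProbabilityMeasure_of_mem_couplings hμ hγ
  have hS := cyclicallyMonotone_support hγ hmin (by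
    rw [cost_eq_ofReal hμ hν hγ]
    exact ENNReal.ofReal_ne_top)
  have hsupp : ∀ᵐ z ∂γ, z ∈ γ.support := Measure.support_mem_ae
  obtain ⟨p, hp⟩ := hsupp.exists
  have hc := hS.isConvex_rockafellar hp
  have hdγ : ∀ᵐ z ∂γ, IsDiffAt (rockafellar γ.support p) z.1 := by
    -- The density of `μ` enters here, turning Lebesgue-null exceptional sets into `μ`-null ones.
    have h := (measurePreserving_fst hγ).quasiMeasurePreserving.ae (hdens.ae_le hc.ae_isDiffAt)
    filter_upwards [h, hsupp] with z hz hzs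
    exact hz (hS.rockafellar_lt_top hzs)
  refine ⟨_, hc, ?_, γ, hγ, ?_⟩
  · rw [← hγ.1, ae_map_iff measurable_fst.aemeasurable (measurableSet_isDiffAt _)]
    exact hdγ
  · filter_upwards [hdγ, hsupp] with z hz hzs
    exact hS.eq_grad_rockafellar hp hzs hz

end OT

/-! ### Laws of graphs and the main theorem -/

namespace OT

open Set Filter Topology

variable {d : ℕ} {μ ν : Measure (Rd d)} {ψ : Rd d → EReal} {Ω : Type*} [MeasurableSpace Ω]
  {P : Measure Ω} {X : Ω → Rd d}

lemma IsConvex.ae_isDiffAt_of_hasLaw (hψ : IsConvex ψ) (hdens : μ ≪ volume)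
    (hX : HasLaw X μ P) (hfin : ∀ᵐ ω ∂P, ψ (X ω) < ⊤) : ∀ᵐ ω ∂P, IsDiffAt ψ (X ω) := by
  have h := hdens.ae_le hψ.ae_isDiffAt
  rw [← hX.map_eq] at h
  filter_upwards [ae_of_ae_map hX.aemeasurable h, hfin] with ω h1 h2 using h1 h2

lemma ae_isDiffAt_law (hX : HasLaw X μ P) (h : ∀ᵐ ω ∂P, IsDiffAt ψ (X ω)) :
    ∀ᵐ x ∂μ, IsDiffAt ψ x := by
  rw [← hX.map_eq, ae_map_iff hX.aemeasurable (measurableSet_isDiffAt ψ)]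
  exact h

lemma hasLaw_graph (hX : HasLaw X μ P) (ψ : Rd d → EReal) :
    HasLaw (fun ω => (X ω, grad ψ (X ω))) (μ.map fun x => (x, grad ψ x)) P := by
  have hm : Measurable fun x => (x, grad ψ x) := measurable_id.prodMk (measurable_grad ψ)
  refine ⟨hm.comp_aemeasurable hX.aemeasurable, ?_⟩
  rw [← hX.map_eq, AEMeasurable.map_map_of_aemeasurable hm.aemeasurable hX.aemeasurable]
  rfl

lemma ae_graph (μ : Measure (Rd d)) (ψ : Rd d → EReal) :
    ∀ᵐ z ∂(μ.map fun x => (x, grad ψ x)), z.2 = grad ψ z.1 := by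
  have hm : Measurable fun x => (x, grad ψ x) := measurable_id.prodMk (measurable_grad ψ)
  have hs : MeasurableSet {z : Rd d × Rd d | z.2 = grad ψ z.1} :=
    measurableSet_eq_fun measurable_snd ((measurable_grad ψ).comp measurable_fst)
  rw [ae_map_iff hm.aemeasurable hs]
  exact Eventually.of_forall fun _ => rfl

lemma graph_mem_couplings (hX : HasLaw X μ P) (hν : HasLaw (fun ω => grad ψ (X ω)) ν P) :
    (μ.map fun x => (x, grad ψ x)) ∈ couplings μ ν := by
  have hm : Measurable fun x => (x, grad ψ x) := measurable_id.prodMk (measurable_grad ψ)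
  refine ⟨?_, ?_⟩
  · rw [Measure.map_map measurable_fst hm]
    exact Measure.map_id
  · rw [Measure.map_map measurable_snd hm, ← hν.map_eq, ← hX.map_eq,
      AEMeasurable.map_map_of_aemeasurable (measurable_snd.comp hm).aemeasurable hX.aemeasurable]
    rfl

end OT

theorem mainTheorem2 {d : ℕ} (μ ν : Measure (OT.Rd d)) (hμ : μ ∈ OT.P2 d) (hν : ν ∈ OT.P2 d)
    (hdens : μ ≪ volume)
    {Ω : Type*} [MeasurableSpace Ω] (P : Measure Ω) (X : Ω → OT.Rd d) (hX : HasLaw X μ P) :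
    -- existence of an optimal coupling induced by the gradient of a convex function
    (∃ φ : OT.Rd d → EReal, OT.IsConvex φ ∧ (∀ᵐ ω ∂P, OT.IsDiffAt φ (X ω)) ∧
      (∃ γ : Measure (OT.Rd d × OT.Rd d),
        HasLaw (fun ω => (X ω, OT.grad φ (X ω))) γ P ∧ OT.IsOptimalCoupling μ ν γ) ∧
      -- uniqueness of the gradient
      ∀ ψ : OT.Rd d → EReal, OT.IsConvex ψ → (∀ᵐ ω ∂P, ψ (X ω) < ⊤) →
        HasLaw (fun ω => OT.grad ψ (X ω)) ν P →
        ∀ᵐ ω ∂P, OT.IsDiffAt ψ (X ω) ∧ OT.grad ψ (X ω) = OT.grad φ (X ω)) ∧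
    -- a coupling induced by the gradient of a convex function is the unique optimal coupling
    (∀ γ ∈ OT.couplings μ ν, ∀ ψ : OT.Rd d → EReal, OT.IsConvex ψ →
      (∀ᵐ ω ∂P, ψ (X ω) < ⊤) → HasLaw (fun ω => (X ω, OT.grad ψ (X ω))) γ P →
      OT.IsOptimalCoupling μ ν γ ∧ ∀ γ', OT.IsOptimalCoupling μ ν γ' → γ' = γ) := by
  constructor
  · obtain ⟨φ, hφ, hd, γ, hγ, hg⟩ := OT.exists_isConvex_grad hμ hν hdens
    have hopt := fun γ' (hγ' : γ' ∈ OT.couplings μ ν) =>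
      (OT.cost_le_of_grad hμ hν hφ hd hγ hg hγ').1
    have hγeq := OT.eq_map_of_ae_eq_snd (OT.measurable_grad φ) hγ hg
    have hlaw : HasLaw (fun ω => (X ω, OT.grad φ (X ω))) γ P := hγeq ▸ OT.hasLaw_graph hX φ
    refine ⟨φ, hφ, ae_of_ae_map hX.aemeasurable (hX.map_eq.symm ▸ hd),
      ⟨γ, hlaw, OT.isOptimalCoupling_of_le hγ hopt⟩, ?_⟩
    intro ψ hψ hfin hψν
    have hdψ := hψ.ae_isDiffAt_of_hasLaw hdens hX hfin
    have hmem := OT.graph_mem_couplings hX hψν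
    -- The optimal `γ` costs no more than the graph coupling of `∇ψ`, so it is carried by both
    -- graphs.
    have hgψ := (OT.cost_le_of_grad hμ hν hψ (OT.ae_isDiffAt_law hX hdψ) hmem
      (OT.ae_graph μ ψ) hγ).2 (hopt _ hmem)
    rw [← hlaw.map_eq] at hgψ
    filter_upwards [hdψ, ae_of_ae_map hlaw.aemeasurable hgψ] with ω h1 h2
    exact ⟨h1, h2.symm⟩
  · intro γ hγ ψ hψ hfin hlaw
    have hd := OT.ae_isDiffAt_law hX (hψ.ae_isDiffAt_of_hasLaw hdens hX hfin)
    have hγeq : γ = μ.map fun x => (x, OT.grad ψ x) :=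
      hlaw.map_eq.symm.trans (OT.hasLaw_graph hX ψ).map_eq
    have hg : ∀ᵐ z ∂γ, z.2 = OT.grad ψ z.1 := hγeq ▸ OT.ae_graph μ ψ
    refine ⟨OT.isOptimalCoupling_of_le hγ fun γ' hγ' =>
      (OT.cost_le_of_grad hμ hν hψ hd hγ hg hγ').1, fun γ' hγ' => ?_⟩
    have hg' := (OT.cost_le_of_grad hμ hν hψ hd hγ hg hγ'.mem).2
      (hγ'.isLeast.2 (Set.mem_image_of_mem _ hγ))
    rw [OT.eq_map_of_ae_eq_snd (OT.measurable_grad ψ) hγ'.mem hg', hγeq]
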